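/- **Setting.** Let $n=2m$ be even, $m\ge 0$. A cell is a point of $(\mathbb Z+\tfrac12)^2$, and for even $k\ge -2$ let $\mathcal D_k$ be the set of cells $(x,y)$ with $|x|+|y|\le (k+2)/2$. A *domino* is a pair $(\omega_1,\omega_2=\omega_1+e)$, $e\in\{(1,0),(0,1)\}$ (horizontal or vertical); its *kernel* is $\{\omega_1,\omega_2\}$ and its *hull* consists of the other $10$ cells at $\ell^\infty$-distance at most $1$ from $\omega_1$ or $\omega_2$. A finite set of dominos is an *admissible arrangement in $\mathcal D_n$* if all kernels are contained in $\mathcal D_{n-2}$ and no hull of a domino of the set meets a kernel of a domino of the set. **Parameters.** Put $p=\lfloor m/3\rfloor$, $\hat p=p+1-(m \bmod 3)$ and $\hat p=4q+r$ with $q\in\mathbb Z$, $0\le r<4$ (so $r$ is the residue mod $4$ of $p+1$, $p$, $p-1$ for $m\equiv 0,1,2 \pmod 3$ respectively). Put $f=m+1-r$, $h=p-q$, $b=(q-1)+\delta$ where $\delta$ is the integer nearest to $(r+(m\bmod 3))/3$, and $$W'=\frac{h(h+1)}2,\qquad W''=\frac{b\,\big((h-3)+(h-3b)\big)}2 .$$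 Let $\xi_0=0$, $\xi_1=0$, $\xi_2=1$, $\xi_3=2$, $\xi_4=4$, $\xi_5=6$, $\xi_k=\xi_{k-6}+2(k-2)$ for $k\ge 6$. Put $\psi_4=2$ and $\psi_n=\xi_f+4(W'+W'')$ for every even $n\neq 4$. **Construction.** (Core) In the central $f\times f$ square take concentric crowns: in the central square of even side $s\ge4$, the crown consists of the $s/2-1$ vertical dominos with kernels $\{(x,\tfrac{s-3}2),(x,\tfrac{s-1}2)\}$, $x=-\tfrac{s-1}2+2t$, $0\le t<s/2-1$, and of their images under the rotations by $90^\circ,180^\circ,270^\circ$ about the origin; continue in the central square of side $s-6$; a square of side $2$ gets one horizontal domino and a square of side $0$ (or less) gets none. (Wedges) For $0\le i<h$, the strip of the $4i+2$ cells $(x,\,m-\tfrac12-2i)$ with $|x|\le 2i+\tfrac12$ is filled from its left end with $(i+1)+\lfloor i/3\rfloor$ horizontal dominos, the left cells of consecutive kernels being $3$ apart. The first $i+1$ dominos of each strip form the first North subwedge, the others form the second North subwedge, with one exception: if $m\equiv2\pmod 3$ and $r=3$, the last domino of the lowest strip $i=h-1$ is replaced by the vertical domino whose lower kernel cell is the left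 kernel cell of the replaced domino. The construction is the union of the core, the two North subwedges and the images of these subwedges under the rotations by $90^\circ,180^\circ,270^\circ$. **Statement.** For every even $n=2m\ge0$: 1. If $n\ne4$, then the construction is an admissible arrangement in $\mathcal D_n$ and has exactly $\psi_n$ dominos. Moreover $f$ is even, the core consists of $\xi_f$ dominos with kernels in the central $f\times f$ square, and the first and second North subwedges consist of $W'$ and $W''$ dominos, respectively, with kernels among the cells with $y\ge (f+3)/2$, i.e. above the bordered core (the central square of side $f+2$). 2. If $n\neq 4$, then $\psi_n=\dfrac{n^2+2n+c}{12}$, where for $r=0,1,2,3$ the constant $c$ is - $24,\ 0,\ 12,\ 24$ if $m\equiv0\pmod 3$, - $4,\ 16,\ 16,\ 4$ if $m\equiv1\pmod 3$, - $24,\ 12,\ 0,\ 24$ if $m\equiv2\pmod 3$. 3. $\psi_0=0$, $\psi_2=1$, $\psi_4=2$, and $\psi_n=\psi_{n-24}+4(n-11)$ whenever $n\ge24$ and $n\ne 28$. 4. The maximum number of dominos in an admissible arrangement in $\mathcal D_n$ exists and is at least $\psi_n$. -/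

import Mathlib

namespace DominoDiamond

/-! ### Cells, dominos, diamonds

For even `n` the cells of the lattice have half-integer centers.  The pair `(x, y) : ℤ × ℤ`
stands for the cell with center `(x + 1/2, y + 1/2)`. -/

abbrev Cell : Type := ℤ × ℤ

/-- The two basis vectors `e_x` (horizontal domino) and `e_y` (vertical domino). -/
inductive Dir : Type
  | ex
  | ey
  deriving DecidableEq

def Dir.vec : Dir → ℤ × ℤ
  | .ex => (1, 0)
  | .ey => (0, 1)

/-- A domino `(ω₁, ω₁ + e)`, given by its anchor `ω₁` and `e ∈ {e_x, e_y}`. -/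
structure Domino : Type where
  anchor : Cell
  dir : Dir
  deriving DecidableEq

/-- The Moore neighborhood of range 1. -/
def moore (c : Cell) : Set Cell := {z | |z.1 - c.1| ≤ 1 ∧ |z.2 - c.2| ≤ 1}

/-- The second cell `ω₂ = ω₁ + e` of the kernel. -/
def Domino.second (d : Domino) : Cell := d.anchor + d.dir.vec

/-- The 2-cell kernel. -/
def Domino.kernel (d : Domino) : Set Cell := {d.anchor, d.second}

/-- The 12-cell domino. -/
def Domino.body (d : Domino) : Set Cell := moore d.anchor ∪ moore d.second

/-- The 10-cell hull. -/
def Domino.hull (d : Domino) : Set Cell := d.body \ d.kernel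

/-- The diamond `𝒟_n`, `n` even: cells whose centers satisfy `|X| + |Y| ≤ r`, `2 r = n + 2`
(an Aztec diamond; empty for `n = -2`). -/
def diamond (n : ℤ) : Set Cell := {c | |2 * c.1 + 1| + |2 * c.2 + 1| ≤ n + 2}

/-- An admissible arrangement of dominos in `𝒟_n`: all kernels lie in `𝒟_{n-2}`, and no hull meets
a kernel. -/
def Admissible (n : ℕ) (A : Finset Domino) : Prop :=
  (∀ d ∈ A, d.kernel ⊆ diamond ((n : ℤ) - 2)) ∧
    ∀ d ∈ A, ∀ d' ∈ A, d'.hull ∩ d.kernel = ∅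

/-- The maximum number of dominos in an admissible arrangement in `𝒟_n`. -/
noncomputable def maxDominos (n : ℕ) : ℕ :=
  sSup {k | ∃ A : Finset Domino, Admissible n A ∧ A.card = k}

/-! ### Parameters of the construction for `n = 2 m`, `p = ⌊m / 3⌋` -/

/-- `p̂ = p + 1 - (m mod 3)`: it is `p + 1`, `p`, `p - 1` in the three classes. -/
def pHat (m : ℕ) : ℤ := ((m / 3 : ℕ) : ℤ) + 1 - ((m % 3 : ℕ) : ℤ)

/-- The quotient in `p̂ = 4 q + r`, `0 ≤ r < 4`. -/
def qHat (m : ℕ) : ℤ := pHat m / 4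

/-- The remainder in `p̂ = 4 q + r`, `0 ≤ r < 4`. -/
def rHat (m : ℕ) : ℕ := (pHat m % 4).toNat

/-- The side `f(m) = m + 1 - r` of the square core. -/
def coreSide (m : ℕ) : ℕ := m + 1 - rHat m

/-- The number `p - q` of rows of dominos in a wedge. -/
def rows (m : ℕ) : ℤ := ((m / 3 : ℕ) : ℤ) - qHat m

/-- The capacity `ξ_n` of the square, by its inductive formula. -/
def xi : ℕ → ℕ
  | 0 => 0
  | 1 => 0
  | 2 => 1
  | 3 => 2
  | 4 => 4
  | 5 => 6
  | n + 6 => xi n + 2 * ((n + 6) - 2)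

/-- The capacity `W'` of the first subwedge. -/
def capW' (m : ℕ) : ℚ := (rows m : ℚ) * ((rows m : ℚ) + 1) / 2

/-- The capacity of the baserow of the second subwedge: `(q - 1) + δ`, where `δ` is the integer
nearest to `(r + (m mod 3)) / 3`. -/
def baseW'' (m : ℕ) : ℤ := (qHat m - 1) + round (((rHat m : ℚ) + ((m % 3 : ℕ) : ℚ)) / 3)

/-- The capacity `W''` of the second subwedge. -/
def capW'' (m : ℕ) : ℚ :=
  (baseW'' m : ℚ) * (((rows m : ℚ) - 3) + ((rows m : ℚ) - 3 * (baseW'' m : ℚ))) / 2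

/-- The capacity `ψ_n` for even `n`: core plus four split wedges.  The size `n = 4`, where the
core-wedge structure does not yet appear, has its own initial value `ψ_4 = 2`. -/
def psi (n : ℕ) : ℚ :=
  if n = 4 then 2 else (xi (coreSide (n / 2)) : ℚ) + 4 * (capW' (n / 2) + capW'' (n / 2))

/-- The constant `c` in `ψ_n = (n² + 2 n + c) / 12`, depending on `m mod 3` and `r`. -/
def classConst : ℕ → ℕ → ℚ
  | 0, 0 => 24
  | 0, 1 => 0
  | 0, 2 => 12
  | 0, 3 => 24
  | 1, 0 => 4
  | 1, 1 => 16
  | 1, 2 => 16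
  | 1, 3 => 4
  | 2, 0 => 24
  | 2, 1 => 12
  | 2, 2 => 0
  | 2, 3 => 24
  | _, _ => 0

/-! ### The construction -/

/-- The image of a domino under the rotation `(X, Y) ↦ (-Y, X)` of the plane. -/
def Domino.rot : Domino → Domino
  | ⟨(x, y), .ex⟩ => ⟨(-y - 1, x), .ey⟩
  | ⟨(x, y), .ey⟩ => ⟨(-y - 2, x), .ex⟩

/-- Union of an arrangement with its images under the rotations of 90, 180, 270 degrees. -/
def fourfold (A : Finset Domino) : Finset Domino :=
  A ∪ A.image Domino.rot ∪ (A.image Domino.rot).image Domino.rot ∪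
    ((A.image Domino.rot).image Domino.rot).image Domino.rot

/-- The crown of thickness 3 along the border of the square of side `2 h`: four rotated rows
of `h - 1` dominos perpendicular to the side. -/
def crown (h : ℕ) : Finset Domino :=
  fourfold ((Finset.range (h - 1)).image fun t : ℕ =>
    ⟨(-(h : ℤ) + 2 * (t : ℤ), (h : ℤ) - 2), .ey⟩)

/-- Concentric crowns in the square of side `2 h`. -/
def core : ℕ → Finset Domino
  | 0 => ∅
  | 1 => {⟨(-1, 0), .ex⟩}
  | 2 => crown 2
  | h + 3 => crown (h + 3) ∪ core h

/-- First subwedge of the North wedge.  Rows are numbered `i = 0, 1, …` downwards from the top of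
the diamond; row `i` is a strip of `4 i + 2` cells, filled from its left end by horizontal dominos
with period 3, of which the first `i + 1` belong to this subwedge. -/
def subwedge' (m : ℕ) : Finset Domino :=
  (Finset.range (rows m).toNat).biUnion fun i : ℕ =>
    (Finset.range (i + 1)).image fun j : ℕ =>
      ⟨(-2 * (i : ℤ) - 1 + 3 * (j : ℤ), (m : ℤ) - 1 - 2 * (i : ℤ)), .ex⟩

/-- Second subwedge of the North wedge: the remaining `⌊i / 3⌋` dominos of each row `i`.  They are
horizontal, except that for `m ≡ 2 (mod 3)` and `r = 3` the last domino of the baserow is turned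
vertical (otherwise it would touch the East wedge). -/
def subwedge'' (m : ℕ) : Finset Domino :=
  (Finset.range (rows m).toNat).biUnion fun i : ℕ =>
    (Finset.range (i / 3)).image fun t : ℕ =>
      ⟨(-2 * (i : ℤ) - 1 + 3 * ((i : ℤ) + 1 + (t : ℤ)), (m : ℤ) - 1 - 2 * (i : ℤ)),
        if m % 3 = 2 ∧ rHat m = 3 ∧ i + 1 = (rows m).toNat ∧ t + 1 = i / 3 then .ey else .ex⟩

/-- The arrangement in `𝒟_{2m}`: square core and four rotated copies of the split wedge. -/
def construction (m : ℕ) : Finset Domino :=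
  core (coreSide m / 2) ∪ fourfold (subwedge' m ∪ subwedge'' m)

/-- The `f × f` field of cells of a central square of even side `f`. -/
def field (f : ℕ) : Set Cell := {c | |2 * c.1 + 1| ≤ (f : ℤ) ∧ |2 * c.2 + 1| ≤ (f : ℤ)}

/-- The region above the North side of the bordered square of even side `f + 2`. -/
def northOf (f : ℕ) : Set Cell := {c | (f : ℤ) + 2 ≤ 2 * c.2}

end DominoDiamond

/-! Admissibility follows once the kernels of any two distinct dominos are at `ℓ^∞`-distance at
least 2 (`Packing.admissible`), so only cell distances matter.

The geometric engine is a pinwheel, `packing_union_fourfold`: a packing in the central square of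
side `2K`, together with four rotated copies of a packing in the blade `y > K`, `x < K`, is again a
packing, and the counts add. It is used twice. With a crown row as the blade packing and induction
on the half side it builds the core; with the North wedge as the blade packing and the core in the
middle it builds the whole construction. What remains is to check that the wedge is a packing inside
the blade and the diamond.

For the arithmetic, `params` makes `m`, the half side `H` of the core and the number `R` of strips
linear in `q`, with offsets depending on `r` and `s = m % 3`. The count is then a quadratic in `q`
for each of the twelve pairs `(r, s)`. The recurrence follows because `m ↦ m - 12` preserves both
residues. Only `m = 2` has negative `q`; there two dominos are exhibited directly. -/

namespace DominoDiamond

/-! ### Separated dominos and rotations -/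

/-- Two cells at `ℓ^∞`-distance at least `2`. -/
def Far (c c' : Cell) : Prop :=
  2 ≤ c.1 - c'.1 ∨ 2 ≤ c'.1 - c.1 ∨ 2 ≤ c.2 - c'.2 ∨ 2 ≤ c'.2 - c.2

/-- Two dominos all of whose kernel cells are at `ℓ^∞`-distance at least `2`. -/
def Separated (d d' : Domino) : Prop :=
  ∀ c ∈ d.kernel, ∀ c' ∈ d'.kernel, Far c c'

/-- Distinct dominos of the set are separated. -/
def Packing (A : Finset Domino) : Prop :=
  ∀ d ∈ A, ∀ d' ∈ A, d ≠ d' → Separated d d'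

/-- The rotation by 90 degrees on cells. -/
def rotCell (c : Cell) : Cell := (-c.2 - 1, c.1)

theorem mem_kernel_ex {x y : ℤ} {c : Cell} :
    c ∈ Domino.kernel ⟨(x, y), .ex⟩ ↔ (c.1 = x ∨ c.1 = x + 1) ∧ c.2 = y := by
  obtain ⟨a, b⟩ := c
  simp only [Domino.kernel, Domino.second, Dir.vec, Set.mem_insert_iff, Set.mem_singleton_iff,
    Prod.mk_add_mk, Prod.mk.injEq]
  omega

theorem mem_kernel_ey {x y : ℤ} {c : Cell} :
    c ∈ Domino.kernel ⟨(x, y), .ey⟩ ↔ c.1 = x ∧ (c.2 = y ∨ c.2 = y + 1) := by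
  obtain ⟨a, b⟩ := c
  simp only [Domino.kernel, Domino.second, Dir.vec, Set.mem_insert_iff, Set.mem_singleton_iff,
    Prod.mk_add_mk, Prod.mk.injEq]
  omega

theorem anchor_mem_kernel (d : Domino) : d.anchor ∈ d.kernel := by
  simp [Domino.kernel]

theorem Far.symm {c c' : Cell} (h : Far c c') : Far c' c := by
  unfold Far at *
  omega

theorem Separated.symm {d d' : Domino} (h : Separated d d') : Separated d' d :=
  fun c hc c' hc' => (h c' hc' c hc).symm

theorem Separated.ne {d d' : Domino} (h : Separated d d') : d ≠ d' := by
  rintro rfl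
  have := h _ (anchor_mem_kernel d) _ (anchor_mem_kernel d)
  unfold Far at this
  omega

/-- A vertical domino gets the image of its upper cell as new anchor, so anchors do not rotate to
anchors. Kernels as sets do, and this reduces all statements about rotated dominos to `rotCell`. -/
theorem mem_kernel_rot {d : Domino} {c : Cell} :
    c ∈ d.rot.kernel ↔ ∃ c₀ ∈ d.kernel, c = rotCell c₀ := by
  obtain ⟨⟨x, y⟩, e⟩ := d
  cases e
  · simp only [Domino.rot, mem_kernel_ex, mem_kernel_ey, rotCell]
    constructor
    · intro h
      refine ⟨(c.2, -c.1 - 1), by simp only; omega, ?_⟩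
      ext <;> simp
    · rintro ⟨c₀, h, rfl⟩
      simp only
      omega
  · simp only [Domino.rot, mem_kernel_ex, mem_kernel_ey, rotCell]
    constructor
    · intro h
      refine ⟨(c.2, -c.1 - 1), by simp only; omega, ?_⟩
      ext <;> simp
    · rintro ⟨c₀, h, rfl⟩
      simp only
      omega

theorem Separated.rot {d d' : Domino} (h : Separated d d') : Separated d.rot d'.rot := by
  intro c hc c' hc'
  obtain ⟨c₀, h₀, rfl⟩ := mem_kernel_rot.1 hc
  obtain ⟨c₁, h₁, rfl⟩ := mem_kernel_rot.1 hc'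
  have := h _ h₀ _ h₁
  simp only [Far, rotCell] at *
  omega

theorem rot_injective : Function.Injective Domino.rot := by
  rintro ⟨⟨x, y⟩, e⟩ ⟨⟨x', y'⟩, e'⟩ h
  cases e <;> cases e' <;> simp [Domino.rot] at h ⊢ <;> omega

theorem Packing.rot {A : Finset Domino} (h : Packing A) : Packing (A.image Domino.rot) := by
  intro d hd d' hd' hne
  obtain ⟨a, ha, rfl⟩ := Finset.mem_image.1 hd
  obtain ⟨b, hb, rfl⟩ := Finset.mem_image.1 hd'
  exact (h a ha b hb fun hab => hne (by rw [hab])).rot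

/-- Union of two packings separated from each other. -/
theorem Packing.union {A B : Finset Domino} (hA : Packing A) (hB : Packing B)
    (hAB : ∀ a ∈ A, ∀ b ∈ B, Separated a b) : Packing (A ∪ B) := by
  intro d hd d' hd' hne
  rcases Finset.mem_union.1 hd with h | h <;> rcases Finset.mem_union.1 hd' with h' | h'
  · exact hA d h d' h' hne
  · exact hAB d h d' h'
  · exact (hAB d' h' d h).symm
  · exact hB d h d' h' hne

theorem card_union_of_separated {A B : Finset Domino}
    (hAB : ∀ a ∈ A, ∀ b ∈ B, Separated a b) : (A ∪ B).card = A.card + B.card := by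
  apply Finset.card_union_of_disjoint
  rw [Finset.disjoint_left]
  intro d hA hB
  exact (hAB d hA d hB).ne rfl

/-- All kernel cells of the arrangement satisfy the predicate. -/
def KernelsIn (A : Finset Domino) (P : Cell → Prop) : Prop :=
  ∀ d ∈ A, ∀ c ∈ d.kernel, P c

theorem KernelsIn.rot {A : Finset Domino} {P Q : Cell → Prop} (h : KernelsIn A P)
    (hPQ : ∀ c, P c → Q (rotCell c)) : KernelsIn (A.image Domino.rot) Q := by
  intro d hd c hc
  obtain ⟨a, ha, rfl⟩ := Finset.mem_image.1 hd
  obtain ⟨c₀, h₀, rfl⟩ := mem_kernel_rot.1 hc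
  exact hPQ _ (h a ha c₀ h₀)

theorem KernelsIn.union {A B : Finset Domino} {P : Cell → Prop} (hA : KernelsIn A P)
    (hB : KernelsIn B P) : KernelsIn (A ∪ B) P := by
  intro d hd
  rcases Finset.mem_union.1 hd with h | h
  · exact hA d h
  · exact hB d h

theorem KernelsIn.separated {A B : Finset Domino} {P Q : Cell → Prop} (hA : KernelsIn A P)
    (hB : KernelsIn B Q) (hPQ : ∀ c c', P c → Q c' → Far c c') :
    ∀ a ∈ A, ∀ b ∈ B, Separated a b :=
  fun a ha b hb c hc c' hc' => hPQ c c' (hA a ha c hc) (hB b hb c' hc')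

theorem KernelsIn.fourfold {A : Finset Domino} {P : Cell → Prop} (h : KernelsIn A P)
    (hP : ∀ c, P c → P (rotCell c)) : KernelsIn (fourfold A) P :=
  ((h.union (h.rot hP)).union ((h.rot hP).rot hP)).union (((h.rot hP).rot hP).rot hP)

/-- The central square of side `2 K`, in coordinates. -/
def InSquare (K : ℤ) (c : Cell) : Prop := -K ≤ c.1 ∧ c.1 < K ∧ -K ≤ c.2 ∧ c.2 < K

/-- The region above the square of side `2 K + 2` and left of its East border; its four rotated
images are at distance at least `2` from each other and from the square of side `2 K`. -/
def InBlade (K : ℤ) (c : Cell) : Prop := K < c.2 ∧ c.1 < K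

/-- A packing in a central square together with four rotated images of a packing in a blade. -/
theorem packing_union_fourfold {K : ℤ} {C A : Finset Domino} (hC : Packing C) (hA : Packing A)
    (hCK : KernelsIn C (InSquare K)) (hAK : KernelsIn A (InBlade K)) :
    Packing (C ∪ fourfold A) ∧ (C ∪ fourfold A).card = C.card + 4 * A.card := by
  -- The West, South and East blades. Each overshoots the square at one end only, so a blade stops
  -- one free line before the next one begins. The bounds also work for negative `K`.
  have h1 : KernelsIn (A.image Domino.rot) fun c => c.1 < -K - 1 ∧ c.2 < K :=
    hAK.rot fun c hc => by simp only [InBlade, rotCell] at *; omega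
  have h2 : KernelsIn ((A.image Domino.rot).image Domino.rot)
      fun c => c.2 < -K - 1 ∧ -K ≤ c.1 :=
    h1.rot fun c hc => by simp only [rotCell] at *; omega
  have h3 : KernelsIn (((A.image Domino.rot).image Domino.rot).image Domino.rot)
      fun c => K < c.1 ∧ -K ≤ c.2 :=
    h2.rot fun c hc => by simp only [rotCell] at *; omega
  have s1 := hAK.separated h1 fun c c' hc hc' => by simp only [InBlade, Far] at *; omega
  have s2 : ∀ a ∈ A ∪ A.image Domino.rot, ∀ b ∈ (A.image Domino.rot).image Domino.rot,
      Separated a b := by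
    intro a ha
    rcases Finset.mem_union.1 ha with ha | ha
    · exact hAK.separated h2 (fun c c' hc hc' => by simp only [InBlade, Far] at *; omega) a ha
    · exact h1.separated h2 (fun c c' hc hc' => by simp only [Far] at *; omega) a ha
  have s3 : ∀ a ∈ A ∪ A.image Domino.rot ∪ (A.image Domino.rot).image Domino.rot,
      ∀ b ∈ ((A.image Domino.rot).image Domino.rot).image Domino.rot, Separated a b := by
    intro a ha
    rcases Finset.mem_union.1 ha with ha | ha
    · rcases Finset.mem_union.1 ha with ha | ha
      · exact hAK.separated h3 (fun c c' hc hc' => by simp only [InBlade, Far] at *; omega) a ha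
      · exact h1.separated h3 (fun c c' hc hc' => by simp only [Far] at *; omega) a ha
    · exact h2.separated h3 (fun c c' hc hc' => by simp only [Far] at *; omega) a ha
  have s4 : ∀ a ∈ C, ∀ b ∈ fourfold A, Separated a b := by
    intro a ha b hb
    simp only [fourfold] at hb
    rcases Finset.mem_union.1 hb with hb | hb
    · rcases Finset.mem_union.1 hb with hb | hb
      · rcases Finset.mem_union.1 hb with hb | hb
        · exact hCK.separated hAK (fun c c' hc hc' => by
            simp only [InBlade, InSquare, Far] at *; omega) a ha b hb
        · exact hCK.separated h1 (fun c c' hc hc' => by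
            simp only [InSquare, Far] at *; omega) a ha b hb
      · exact hCK.separated h2 (fun c c' hc hc' => by
          simp only [InSquare, Far] at *; omega) a ha b hb
    · exact hCK.separated h3 (fun c c' hc hc' => by
        simp only [InSquare, Far] at *; omega) a ha b hb
  constructor
  · refine hC.union ?_ s4
    exact ((hA.union hA.rot s1).union hA.rot.rot s2).union hA.rot.rot.rot s3
  · rw [card_union_of_separated s4, fourfold, card_union_of_separated s3,
      card_union_of_separated s2, card_union_of_separated s1]
    simp only [Finset.card_image_of_injective _ rot_injective]
    ring

/-- A cell in the hull of `d'` and the kernel of `d` forces `d ≠ d'`, yet lies within distance 1 of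
a kernel cell of `d'`. -/
theorem Packing.admissible {n : ℕ} {A : Finset Domino} (hA : Packing A)
    (hn : KernelsIn A (· ∈ diamond ((n : ℤ) - 2))) : Admissible n A := by
  refine ⟨fun d hd c hc => hn d hd c hc, fun d hd d' hd' => ?_⟩
  rw [Set.eq_empty_iff_forall_notMem]
  rintro c ⟨⟨hb, hk⟩, hc⟩
  have hne : d ≠ d' := by
    rintro rfl
    exact hk hc
  have hs := hA d hd d' hd' hne c hc
  rcases hb with hb | hb
  · have := hs d'.anchor (anchor_mem_kernel d')
    simp only [moore, Set.mem_ofPred_eq, abs_le] at hb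
    unfold Far at this
    omega
  · have := hs d'.second (by simp [Domino.kernel])
    simp only [moore, Set.mem_ofPred_eq, abs_le] at hb
    unfold Far at this
    omega

theorem mem_diamond_rotCell {k : ℤ} {c : Cell} (h : c ∈ diamond k) : rotCell c ∈ diamond k := by
  simp only [diamond, rotCell, Set.mem_ofPred_eq] at *
  have : |2 * (-c.2 - 1) + 1| = |2 * c.2 + 1| := by
    rw [← abs_neg]
    congr 1
    ring
  rw [this]
  linarith

/-! ### The core -/

/-- The North row of a crown. -/
def crownRow (h : ℕ) : Finset Domino :=
  (Finset.range (h - 1)).image fun t : ℕ => ⟨(-(h : ℤ) + 2 * (t : ℤ), (h : ℤ) - 2), .ey⟩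

theorem crown_eq (h : ℕ) : crown h = fourfold (crownRow h) := rfl

theorem card_crownRow (h : ℕ) : (crownRow h).card = h - 1 := by
  rw [crownRow, Finset.card_image_of_injective, Finset.card_range]
  intro a b hab
  simp only [Domino.mk.injEq, Prod.mk.injEq] at hab
  omega

theorem packing_crownRow (h : ℕ) : Packing (crownRow h) := by
  intro d hd d' hd' hne c hc c' hc'
  simp only [crownRow, Finset.mem_image, Finset.mem_range] at hd hd'
  obtain ⟨t, ht, rfl⟩ := hd
  obtain ⟨t', ht', rfl⟩ := hd'
  have : t ≠ t' := fun h => hne (by rw [h])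
  rw [mem_kernel_ey] at hc hc'
  unfold Far
  omega

theorem crownRow_inBlade (h : ℕ) : KernelsIn (crownRow h) (InBlade ((h : ℤ) - 3)) := by
  intro d hd c hc
  simp only [crownRow, Finset.mem_image, Finset.mem_range] at hd
  obtain ⟨t, ht, rfl⟩ := hd
  rw [mem_kernel_ey] at hc
  unfold InBlade
  omega

theorem crownRow_inSquare (h : ℕ) : KernelsIn (crownRow h) (InSquare h) := by
  intro d hd c hc
  simp only [crownRow, Finset.mem_image, Finset.mem_range] at hd
  obtain ⟨t, ht, rfl⟩ := hd
  rw [mem_kernel_ey] at hc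
  unfold InSquare
  omega

theorem inSquare_rotCell {K : ℤ} {c : Cell} (h : InSquare K c) : InSquare K (rotCell c) := by
  simp only [InSquare, rotCell] at *
  omega

/-- Induction in steps of 3 on the half side: a crown row of the square of half side `h + 3` lies in
the blade over the square of half side `h`, and its four copies add `4 (h + 2)` dominos, the
increment of `xi`. -/
theorem core_spec (h : ℕ) : Packing (core h) ∧ KernelsIn (core h) (InSquare h) ∧
    (core h).card = xi (2 * h) := by
  induction h using core.induct with
  | case1 => simp [core, Packing, KernelsIn, xi]
  | case2 =>
    refine ⟨?_, ?_, by simp [core, xi]⟩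
    · intro d hd d' hd' hne
      simp only [core, Finset.mem_singleton] at hd hd'
      exact absurd (hd.trans hd'.symm) hne
    · intro d hd c hc
      simp only [core, Finset.mem_singleton] at hd
      subst hd
      rw [mem_kernel_ex] at hc
      unfold InSquare
      omega
  | case3 =>
    -- Here `K = -1`: nothing fits inside this crown, so the pinwheel has an empty centre.
    have key := packing_union_fourfold (K := ((2 : ℕ) : ℤ) - 3) (C := ∅) (by simp [Packing])
      (packing_crownRow 2) (by simp [KernelsIn]) (crownRow_inBlade 2)
    rw [Finset.empty_union, card_crownRow, ← crown_eq] at key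
    refine ⟨key.1, ?_, by simpa [core, xi] using key.2⟩
    exact (crownRow_inSquare 2).fourfold fun c => inSquare_rotCell
  | case4 h ih =>
    obtain ⟨ih1, ih2, ih3⟩ := ih
    have hb := crownRow_inBlade (h + 3)
    rw [show ((h + 3 : ℕ) : ℤ) - 3 = h by push_cast; ring] at hb
    have key := packing_union_fourfold ih1 (packing_crownRow (h + 3)) ih2 hb
    rw [← crown_eq, card_crownRow, Finset.union_comm, ih3] at key
    have hx : xi (2 * (h + 3)) = xi (2 * h) + 2 * (2 * h + 6 - 2) := rfl
    refine ⟨key.1, ?_, ?_⟩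
    · refine KernelsIn.union ((crownRow_inSquare _).fourfold fun c => inSquare_rotCell) ?_
      intro d hd c hc
      have := ih2 d hd c hc
      simp only [InSquare] at *
      omega
    · rw [core, key.2, hx]
      omega

theorem inSquare_iff_mem_field {h : ℕ} {c : Cell} : c ∈ field (2 * h) ↔ InSquare h c := by
  simp only [field, InSquare, Set.mem_ofPred_eq, abs_le]
  push_cast
  omega

/-- Closed form of `xi` at even arguments; the correction is the only dependence on `h` modulo 3. -/
theorem xi_two_mul (h : ℕ) :
    3 * xi (2 * h) + (if h % 3 = 1 then 1 else 0) = 2 * h * h + 2 * h := by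
  induction h using core.induct with
  | case1 => simp [xi]
  | case2 => simp [xi]
  | case3 => simp [xi]
  | case4 h ih =>
    have hx : xi (2 * (h + 3)) = xi (2 * h) + 2 * (2 * h + 6 - 2) := rfl
    have h1 : 2 * h + 6 - 2 = 2 * h + 4 := by omega
    simp only [Nat.succ_eq_add_one, add_assoc, Nat.reduceAdd]
    rw [hx, Nat.add_mod_right, h1]
    linarith

/-! ### Parameters -/

/-- Substituting `p = 4q + r + s - 1` makes every parameter linear. The case `m = 2` is excluded
because it alone gives `p̂ = -1`, hence `q = -1`. The equations imply `m = H + 2R`: strips of height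
2 fill the space between the core and the top. -/
theorem params {m : ℕ} (hm : m ≠ 2) : ∃ q r s H R : ℕ, r < 4 ∧ s < 3 ∧ m % 3 = s ∧
    rHat m = r ∧ qHat m = q ∧ m + 3 = 12 * q + 3 * r + 4 * s ∧ coreSide m = 2 * H ∧
    H + 1 = 6 * q + r + 2 * s ∧ rows m = R ∧ R + 1 = 3 * q + r + s := by
  have hp : pHat m = ((m / 3 : ℕ) : ℤ) + 1 - ((m % 3 : ℕ) : ℤ) := rfl
  have hq : qHat m = pHat m / 4 := rfl
  have hr : rHat m = (pHat m % 4).toNat := rfl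
  have hf : coreSide m = m + 1 - rHat m := rfl
  have hw : rows m = ((m / 3 : ℕ) : ℤ) - qHat m := rfl
  refine ⟨(qHat m).toNat, rHat m, m % 3, coreSide m / 2, (rows m).toNat, ?_⟩
  omega

/-- Thirds are never halfway between integers, so rounding is a floor after adding one third. -/
theorem round_third (a b : ℕ) : round (((a : ℚ) + (b : ℚ)) / 3) = (((a + b + 1) / 3 : ℕ) : ℤ) := by
  rw [round_eq, Int.floor_eq_iff]
  have h1 : 3 * ((a + b + 1) / 3) ≤ a + b + 1 := by omega
  have h2 : a + b + 2 ≤ 3 * ((a + b + 1) / 3) + 3 := by omega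
  have h1' : (3 : ℚ) * (((a + b + 1) / 3 : ℕ) : ℚ) ≤ a + b + 1 := by exact_mod_cast h1
  have h2' : (a : ℚ) + b + 2 ≤ 3 * (((a + b + 1) / 3 : ℕ) : ℚ) + 3 := by exact_mod_cast h2
  rw [Int.cast_natCast]
  constructor <;> linarith

/-- For `R > 0` this is `⌊i / 3⌋` at the lowest strip `i = R - 1`. For `R = 0` integer division
gives `-1`, and the formula for `W''` still vanishes. -/
theorem baseW''_eq {m q r s R : ℕ} (hs : m % 3 = s) (hr : rHat m = r) (hq : qHat m = q)
    (hR : R + 1 = 3 * q + r + s) : baseW'' m = ((R : ℤ) - 1) / 3 := by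
  rw [baseW'', hs, hr, hq, round_third]
  omega

theorem sum_div_three (R : ℕ) : 2 * (∑ i ∈ Finset.range R, ((i / 3 : ℕ) : ℤ)) =
    (((R : ℤ) - 1) / 3) * (2 * R - 3 - 3 * (((R : ℤ) - 1) / 3)) := by
  induction R with
  | zero => simp
  | succ R ih =>
    rw [Finset.sum_range_succ, mul_add, ih]
    obtain ⟨k, e, he, rfl⟩ : ∃ k e : ℕ, e < 3 ∧ R = 3 * k + e :=
      ⟨R / 3, R % 3, Nat.mod_lt _ (by norm_num), by omega⟩
    have h1 : (3 * k + e) / 3 = k := by omega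
    have h2 : (((3 * k + e + 1 : ℕ) : ℤ) - 1) / 3 = k := by omega
    rw [h1, h2]
    -- The quotient `(R - 1) / 3` on the old side changes only at `e = 0`, where it is `k - 1`,
    -- possibly `-1`.
    interval_cases e
    · have h3 : (((3 * k + 0 : ℕ) : ℤ) - 1) / 3 = k - 1 := by omega
      rw [h3]
      push_cast
      ring
    · have h3 : (((3 * k + 1 : ℕ) : ℤ) - 1) / 3 = k := by omega
      rw [h3]
      push_cast
      ring
    · have h3 : (((3 * k + 2 : ℕ) : ℤ) - 1) / 3 = k := by omega
      rw [h3]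
      push_cast
      ring

/-! ### The wedge -/

theorem abs_add_abs_le {a b k : ℤ} (h1 : a + b ≤ k) (h2 : a - b ≤ k) (h3 : b - a ≤ k)
    (h4 : -a - b ≤ k) : |a| + |b| ≤ k := by
  rcases abs_cases a with ⟨h, _⟩ | ⟨h, _⟩ <;> rcases abs_cases b with ⟨h', _⟩ | ⟨h', _⟩ <;>
    linarith

theorem card_subwedge' {m R : ℕ} (hR : rows m = R) :
    ((subwedge' m).card : ℚ) = capW' m := by
  have h : (subwedge' m).card = ∑ i ∈ Finset.range R, (i + 1) := by
    rw [subwedge', hR, Int.toNat_natCast, Finset.card_biUnion]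
    · refine Finset.sum_congr rfl fun i _ => ?_
      rw [Finset.card_image_of_injective, Finset.card_range]
      intro a b hab
      simp only [Domino.mk.injEq, Prod.mk.injEq] at hab
      omega
    · intro i _ j _ hij
      rw [Function.onFun, Finset.disjoint_left]
      intro d hd hd'
      obtain ⟨a, _, rfl⟩ := Finset.mem_image.1 hd
      obtain ⟨b, _, hb⟩ := Finset.mem_image.1 hd'
      simp only [Domino.mk.injEq, Prod.mk.injEq] at hb
      omega
  rw [h, capW', hR, eq_div_iff two_ne_zero]
  push_cast
  clear h hR
  induction R with
  | zero => simp
  | succ R ih =>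
    rw [Finset.sum_range_succ, add_mul, ih]
    push_cast
    ring

theorem card_subwedge''_eq_sum {m R : ℕ} (hR : rows m = R) :
    (subwedge'' m).card = ∑ i ∈ Finset.range R, i / 3 := by
  rw [subwedge'', hR, Int.toNat_natCast, Finset.card_biUnion]
  · refine Finset.sum_congr rfl fun i _ => ?_
    rw [Finset.card_image_of_injective, Finset.card_range]
    intro a b hab
    simp only [Domino.mk.injEq, Prod.mk.injEq] at hab
    omega
  · intro i _ j _ hij
    rw [Function.onFun, Finset.disjoint_left]
    intro d hd hd'
    obtain ⟨a, _, rfl⟩ := Finset.mem_image.1 hd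
    obtain ⟨b, _, hb⟩ := Finset.mem_image.1 hd'
    simp only [Domino.mk.injEq, Prod.mk.injEq] at hb
    omega

theorem card_subwedge'' {m : ℕ} (hm : m ≠ 2) : ((subwedge'' m).card : ℚ) = capW'' m := by
  obtain ⟨q, r, s, H, R, -, -, hs, hr, hq, -, -, -, hR, hR'⟩ := params hm
  rw [card_subwedge''_eq_sum hR, capW'', hR, baseW''_eq hs hr hq hR', eq_div_iff two_ne_zero]
  have := congrArg (Int.cast : ℤ → ℚ) (sum_div_three R)
  rw [← Nat.cast_sum] at this
  push_cast [-Nat.cast_sum] at this ⊢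
  linarith

theorem disjoint_subwedges (m : ℕ) : Disjoint (subwedge' m) (subwedge'' m) := by
  rw [Finset.disjoint_left]
  intro d hd hd'
  simp only [subwedge', subwedge'', Finset.mem_biUnion, Finset.mem_image, Finset.mem_range]
    at hd hd'
  obtain ⟨i, -, j, hj, rfl⟩ := hd
  obtain ⟨i', -, t, -, h⟩ := hd'
  simp only [Domino.mk.injEq, Prod.mk.injEq] at h
  omega

/-- Coordinates of the dominos of the North wedge: domino `j` of strip `i` is horizontal, except
possibly the last one of the lowest strip. -/
theorem wedge_cases {m q r s H R : ℕ} (hs : m % 3 = s) (hr : rHat m = r) (hR : rows m = R)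
    (hm : m + 3 = 12 * q + 3 * r + 4 * s) (hH : H + 1 = 6 * q + r + 2 * s)
    (hR' : R + 1 = 3 * q + r + s) {d : Domino} (hd : d ∈ subwedge' m ∪ subwedge'' m) :
    ∃ i j : ℕ, i < R ∧ j ≤ i + i / 3 ∧
      ((¬(s = 2 ∧ r = 3 ∧ i + 1 = R ∧ j = i + i / 3) ∧
          d = ⟨(-2 * (i : ℤ) - 1 + 3 * (j : ℤ), (H : ℤ) + 2 * R - 1 - 2 * (i : ℤ)), .ex⟩) ∨
        ((s = 2 ∧ r = 3 ∧ i + 1 = R ∧ j = i + i / 3) ∧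
          d = ⟨(-2 * (i : ℤ) - 1 + 3 * (j : ℤ), (H : ℤ) + 2 * R - 1 - 2 * (i : ℤ)), .ey⟩)) := by
  have hmH : (m : ℤ) = H + 2 * R := by omega
  rcases Finset.mem_union.1 hd with hd | hd
  · simp only [subwedge', hR, Int.toNat_natCast, Finset.mem_biUnion, Finset.mem_image,
      Finset.mem_range] at hd
    obtain ⟨i, hi, j, hj, rfl⟩ := hd
    refine ⟨i, j, hi, by omega, Or.inl ⟨by omega, ?_⟩⟩
    rw [hmH]
  · simp only [subwedge'', hR, Int.toNat_natCast, Finset.mem_biUnion, Finset.mem_image,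
      Finset.mem_range, hs, hr] at hd
    obtain ⟨i, hi, t, ht, rfl⟩ := hd
    refine ⟨i, i + 1 + t, hi, by omega, ?_⟩
    rw [hmH]
    push_cast
    split_ifs with h
    · exact Or.inr ⟨by omega, rfl⟩
    · exact Or.inl ⟨by omega, rfl⟩

/-- The North wedge is a packing in the blade above the bordered core and in the diamond. -/
theorem wedge_spec {m q r s H R : ℕ} (hs3 : s < 3) (hr4 : r < 4) (hs : m % 3 = s)
    (hr : rHat m = r) (hR : rows m = R)
    (hm : m + 3 = 12 * q + 3 * r + 4 * s) (hH : H + 1 = 6 * q + r + 2 * s)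
    (hR' : R + 1 = 3 * q + r + s) :
    Packing (subwedge' m ∪ subwedge'' m) ∧
      KernelsIn (subwedge' m ∪ subwedge'' m) (InBlade H) ∧
      KernelsIn (subwedge' m ∪ subwedge'' m) (· ∈ diamond (((2 * m : ℕ) : ℤ) - 2)) := by
  refine ⟨fun d hd d' hd' hne c hc c' hc' => ?_, fun d hd c hc => ?_, fun d hd c hc => ?_⟩
  · obtain ⟨i, j, hi, hj, h⟩ := wedge_cases hs hr hR hm hH hR' hd
    obtain ⟨i', j', hi', hj', h'⟩ := wedge_cases hs hr hR hm hH hR' hd'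
    have hij : i = i' → j ≠ j' := by
      rintro rfl rfl
      rcases h with ⟨h0, rfl⟩ | ⟨h0, rfl⟩ <;> rcases h' with ⟨h1, rfl⟩ | ⟨h1, rfl⟩
      · exact hne rfl
      · exact h0 h1
      · exact h1 h0
      · exact hne rfl
    rcases h with ⟨h0, rfl⟩ | ⟨h0, rfl⟩ <;> rcases h' with ⟨h1, rfl⟩ | ⟨h1, rfl⟩ <;>
      simp only [mem_kernel_ex, mem_kernel_ey] at hc hc' <;> unfold Far
    · clear h0 h1 hs hr hR hm hne hd hd'
      omega
    · clear h0 hs hr hR hm hne hd hd'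
      -- The turned domino sits in column `6q + 5`, and its upper cell is one row below the adjacent
      -- strip `3q + 2`. That strip has only `q` extra dominos and ends at column `6q + 2`; strips
      -- further up are far enough vertically.
      have h2 : i' = 3 * q + 3 := by omega
      obtain h3 | h3 | h3 : i = i' ∨ i = 3 * q + 2 ∨ i ≤ 3 * q + 1 := by omega
      all_goals omega
    · clear h1 hs hr hR hm hne hd hd'
      have h2 : i = 3 * q + 3 := by omega
      obtain h3 | h3 | h3 : i' = i ∨ i' = 3 * q + 2 ∨ i' ≤ 3 * q + 1 := by omega
      all_goals omega
    · omega
  -- A strip of horizontal dominos ends at column `i + 3⌊i/3⌋`. This is less than `H` except in the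
  -- lowest strip for `s = 2`, `r = 3`, where it equals `H`; turning the last domino vertical saves
  -- that column.
  · obtain ⟨i, j, hi, hj, h⟩ := wedge_cases hs hr hR hm hH hR' hd
    rcases h with ⟨h0, rfl⟩ | ⟨h0, rfl⟩ <;> simp only [mem_kernel_ex, mem_kernel_ey] at hc <;>
      unfold InBlade <;> omega
  -- Strip `i` is a full row of the diamond, and `i + 3⌊i/3⌋ ≤ 2i` keeps it inside. The upper cell
  -- of the turned domino lies exactly on the boundary of the diamond.
  · obtain ⟨i, j, hi, hj, h⟩ := wedge_cases hs hr hR hm hH hR' hd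
    have hmH : (m : ℤ) = H + 2 * R := by omega
    simp only [diamond, Set.mem_ofPred_eq]
    refine abs_add_abs_le ?_ ?_ ?_ ?_ <;>
      (rcases h with ⟨h0, rfl⟩ | ⟨h0, rfl⟩ <;> simp only [mem_kernel_ex, mem_kernel_ey] at hc <;>
        push_cast <;> omega)

theorem core_inDiamond {m H : ℕ} (h : 2 * H ≤ m + 1) :
    KernelsIn (core H) (· ∈ diamond (((2 * m : ℕ) : ℤ) - 2)) := by
  intro d hd c hc
  have := (core_spec H).2.1 d hd c hc
  simp only [InSquare] at this
  simp only [diamond, Set.mem_ofPred_eq]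
  refine abs_add_abs_le ?_ ?_ ?_ ?_ <;> push_cast <;> omega

/-! ### The construction -/

theorem construction_spec {m : ℕ} (hm2 : m ≠ 2) :
    Admissible (2 * m) (construction m) ∧
      ((construction m).card : ℚ) = psi (2 * m) ∧
      Even (coreSide m) ∧
      (core (coreSide m / 2)).card = xi (coreSide m) ∧
      (∀ d ∈ core (coreSide m / 2), d.kernel ⊆ field (coreSide m)) ∧
      ((subwedge' m).card : ℚ) = capW' m ∧
      ((subwedge'' m).card : ℚ) = capW'' m ∧
      (∀ d ∈ subwedge' m ∪ subwedge'' m, d.kernel ⊆ northOf (coreSide m)) := by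
  have hW'' := card_subwedge'' hm2
  obtain ⟨q, r, s, H, R, hr4, hs3, hs, hr, hq, hm, hf, hH, hR, hR'⟩ := params hm2
  have hW' := card_subwedge' hR
  have hfH : coreSide m / 2 = H := by omega
  obtain ⟨hc1, hc2, hc3⟩ := core_spec H
  obtain ⟨hw1, hw2, hw3⟩ := wedge_spec hs3 hr4 hs hr hR hm hH hR'
  obtain ⟨hp, hcard⟩ := packing_union_fourfold hc1 hw1 hc2 hw2
  refine ⟨?_, ?_, ⟨H, by omega⟩, ?_, ?_, hW', hW'', ?_⟩
  · rw [construction, hfH]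
    refine hp.admissible (KernelsIn.union (core_inDiamond (by omega)) ?_)
    exact hw3.fourfold fun c => mem_diamond_rotCell
  · rw [construction, hfH, hcard, hc3, Finset.card_union_of_disjoint (disjoint_subwedges m), psi,
      if_neg (by omega), Nat.mul_div_cancel_left m two_pos, hf, ← hW', ← hW'']
    push_cast
    ring
  · rw [hfH, hc3, hf]
  · intro d hd c hc
    rw [hfH] at hd
    rw [hf, inSquare_iff_mem_field]
    exact hc2 d hd c hc
  · intro d hd c hc
    have := (hw2 d hd c hc).1
    simp only [northOf, Set.mem_ofPred_eq, hf]
    push_cast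
    omega

/-- For fixed `r` and `s` both sides are quadratics in `q`, since `H % 3` and the rounding depend on
`r` and `s` only. -/
theorem psi_two_mul {m : ℕ} (hm2 : m ≠ 2) :
    psi (2 * m) = (((2 * m : ℕ) : ℚ) ^ 2 + 2 * ((2 * m : ℕ) : ℚ)
      + classConst (m % 3) (rHat m)) / 12 := by
  obtain ⟨q, r, s, H, R, hr4, hs3, hs, hr, hq, hm, hf, hH, hR, hR'⟩ := params hm2
  rw [psi, if_neg (by omega), Nat.mul_div_cancel_left m two_pos, capW', capW'',
    baseW''_eq hs hr hq hR', hR, hf, hs, hr]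
  have hx := congrArg (Nat.cast : ℕ → ℚ) (xi_two_mul H)
  have hm' : (m : ℚ) = 12 * q + 3 * r + 4 * s - 3 := by
    have := congrArg (Nat.cast : ℕ → ℚ) hm
    push_cast at this
    linarith
  have hH' : (H : ℚ) = 6 * q + r + 2 * s - 1 := by
    have := congrArg (Nat.cast : ℕ → ℚ) hH
    push_cast at this
    linarith
  have hRq : (R : ℚ) = 3 * q + r + s - 1 := by
    have := congrArg (Nat.cast : ℕ → ℚ) hR'
    push_cast at this
    linarith
  have hb : ((R : ℤ) - 1) / 3 = q + (((r + s + 1) / 3 : ℕ) : ℤ) - 1 := by omega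
  have hHmod : H % 3 = (r + 2 * s + 2) % 3 := by omega
  rw [hb]
  rw [hHmod] at hx
  push_cast at hx ⊢
  rw [hm', hRq]
  rw [hH'] at hx
  clear hs hr hq hm hf hH hR hR' hm' hH' hRq hb hHmod
  interval_cases r <;> interval_cases s <;> norm_num [classConst] at hx ⊢ <;> linarith

theorem rHat_sub_twelve {m : ℕ} (hm : 12 ≤ m) : rHat (m - 12) = rHat m := by
  simp only [rHat, pHat]
  omega

theorem psi_two_mul_recurrence {m : ℕ} (hm : 12 ≤ m) (hm14 : m ≠ 14) :
    psi (2 * m) = psi (2 * m - 24) + 4 * (((2 * m : ℕ) : ℚ) - 11) := by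
  obtain ⟨k, rfl⟩ := Nat.exists_eq_add_of_le' hm
  have h := rHat_sub_twelve hm
  rw [Nat.add_sub_cancel] at h
  rw [show 2 * (k + 12) - 24 = 2 * k by omega, psi_two_mul (by omega),
    psi_two_mul (by omega : k ≠ 2), h, show (k + 12) % 3 = k % 3 by omega]
  push_cast
  ring

/-! ### The maximum -/

/-- Anchors lie in a finite box, so the cardinalities are bounded and the supremum in `ℕ` is
attained rather than being the default 0. -/
theorem isGreatest_maxDominos (n : ℕ) :
    IsGreatest {k : ℕ | ∃ A : Finset Domino, Admissible n A ∧ A.card = k} (maxDominos n) := by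
  have hne : {k : ℕ | ∃ A : Finset Domino, Admissible n A ∧ A.card = k}.Nonempty :=
    ⟨0, ∅, by simp [Admissible], rfl⟩
  let S : Finset Cell := Finset.Icc (-(n : ℤ) - 1) n ×ˢ Finset.Icc (-(n : ℤ) - 1) n
  let B : Finset Domino := S.image (fun c => ⟨c, .ex⟩) ∪ S.image (fun c => ⟨c, .ey⟩)
  have hbdd : BddAbove {k : ℕ | ∃ A : Finset Domino, Admissible n A ∧ A.card = k} := by
    refine ⟨B.card, ?_⟩
    rintro k ⟨A, hA, rfl⟩
    refine Finset.card_le_card fun d hd => ?_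
    have hc := hA.1 d hd (anchor_mem_kernel d)
    obtain ⟨⟨x, y⟩, e⟩ := d
    have hS : (x, y) ∈ S := by
      simp only [diamond, Set.mem_ofPred_eq] at hc
      have h1 := abs_le.1 (le_trans (le_add_of_nonneg_right (abs_nonneg _)) hc)
      have h2 := abs_le.1 (le_trans (le_add_of_nonneg_left (abs_nonneg _)) hc)
      simp only [S, Finset.mem_product, Finset.mem_Icc]
      omega
    cases e
    · exact Finset.mem_union_left _ (Finset.mem_image_of_mem _ hS)
    · exact Finset.mem_union_right _ (Finset.mem_image_of_mem _ hS)
  exact ⟨Nat.sSup_mem hne hbdd, fun k hk => le_csSup hbdd hk⟩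

/-- Two dominos fit into `𝒟_4`. -/
theorem exists_admissible_four : ∃ A : Finset Domino, Admissible 4 A ∧ A.card = 2 := by
  refine ⟨{⟨(-1, 1), .ex⟩, ⟨(-1, -2), .ex⟩}, Packing.admissible ?_ ?_, by decide⟩
  · intro d hd d' hd' hne c hc c' hc'
    simp only [Finset.mem_insert, Finset.mem_singleton] at hd hd'
    rcases hd with rfl | rfl <;> rcases hd' with rfl | rfl <;>
      first
      | exact absurd rfl hne
      | (rw [mem_kernel_ex] at hc hc'
         unfold Far
         omega)
  · intro d hd c hc
    simp only [Finset.mem_insert, Finset.mem_singleton] at hd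
    simp only [diamond, Set.mem_ofPred_eq]
    rcases hd with rfl | rfl <;> rw [mem_kernel_ex] at hc <;>
      refine abs_add_abs_le ?_ ?_ ?_ ?_ <;> push_cast <;> omega

end DominoDiamond

theorem mainTheorem2 (n m : ℕ) (hn : n = 2 * m) :
    -- the core-plus-split-wedge construction is admissible and has the announced counts
    (n ≠ 4 →
      DominoDiamond.Admissible n (DominoDiamond.construction m) ∧
      ((DominoDiamond.construction m).card : ℚ) = DominoDiamond.psi n ∧
      Even (DominoDiamond.coreSide m) ∧
      (DominoDiamond.core (DominoDiamond.coreSide m / 2)).card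
        = DominoDiamond.xi (DominoDiamond.coreSide m) ∧
      (∀ d ∈ DominoDiamond.core (DominoDiamond.coreSide m / 2),
        d.kernel ⊆ DominoDiamond.field (DominoDiamond.coreSide m)) ∧
      ((DominoDiamond.subwedge' m).card : ℚ) = DominoDiamond.capW' m ∧
      ((DominoDiamond.subwedge'' m).card : ℚ) = DominoDiamond.capW'' m ∧
      (∀ d ∈ DominoDiamond.subwedge' m ∪ DominoDiamond.subwedge'' m,
        d.kernel ⊆ DominoDiamond.northOf (DominoDiamond.coreSide m))) ∧
    -- the explicit count
    (n ≠ 4 →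
      DominoDiamond.psi n = ((n : ℚ) ^ 2 + 2 * (n : ℚ)
        + DominoDiamond.classConst (m % 3) (DominoDiamond.rHat m)) / 12) ∧
    -- the induction
    (DominoDiamond.psi 0 = 0 ∧ DominoDiamond.psi 2 = 1 ∧ DominoDiamond.psi 4 = 2) ∧
    (24 ≤ n → n ≠ 28 →
      DominoDiamond.psi n = DominoDiamond.psi (n - 24) + 4 * ((n : ℚ) - 11)) ∧
    -- the lower bound for the maximum number of dominos
    IsGreatest {k : ℕ | ∃ A : Finset DominoDiamond.Domino,
      DominoDiamond.Admissible n A ∧ A.card = k} (DominoDiamond.maxDominos n) ∧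
    DominoDiamond.psi n ≤ (DominoDiamond.maxDominos n : ℚ) := by
  subst hn
  have h4 : 2 * m ≠ 4 → m ≠ 2 := by omega
  have hmax := DominoDiamond.isGreatest_maxDominos (2 * m)
  refine ⟨fun h => DominoDiamond.construction_spec (h4 h),
    fun h => DominoDiamond.psi_two_mul (h4 h), ⟨?_, ?_, by simp [DominoDiamond.psi]⟩,
    fun h h' => DominoDiamond.psi_two_mul_recurrence (by omega) (by omega), hmax, ?_⟩
  · have h := DominoDiamond.psi_two_mul (m := 0) (by norm_num)
    have hr : DominoDiamond.rHat 0 = 1 := by decide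
    rw [hr] at h
    simpa [DominoDiamond.classConst] using h
  · have h := DominoDiamond.psi_two_mul (m := 1) (by norm_num)
    have hr : DominoDiamond.rHat 1 = 0 := by decide
    rw [hr] at h
    norm_num [DominoDiamond.classConst] at h
    exact h
  · by_cases h : m = 2
    · subst h
      have := hmax.2 DominoDiamond.exists_admissible_four
      simp only [DominoDiamond.psi, Nat.reduceMul, if_true]
      exact_mod_cast this
    · obtain ⟨hadm, hcard, -⟩ := DominoDiamond.construction_spec h
      rw [← hcard]
      exact_mod_cast hmax.2 ⟨_, hadm, rfl⟩
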